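/- **Setting.** Let $n, k \in \mathbb{N}$. Let $\mathrm{Sp}_{2n}$ be the compact symplectic group, i.e. the group of all unitary matrices in $\mathbb{C}^{2n\times 2n}$ of the form $\begin{pmatrix} X & Y\\ -\overline{Y} & \overline{X}\end{pmatrix}$ with $X,Y\in\mathbb{C}^{n\times n}$, and let $\lambda_{\mathrm{Sp}_{2n}}$ be its Haar probability measure. Let $V=\mathbb{C}^{2n}$ with standard basis $e_1,\dots,e_{2n}$, and let $a$ be the skew-symmetric bilinear form on $V$ with $a(e_i,e_{n+i})=1=-a(e_{n+i},e_i)$ for $1\le i\le n$ and $a(e_i,e_j)=0$ if $|i-j|\ne n$; extend it to $V^{\otimes k}$ by $a(\bigotimes_j v_j,\bigotimes_j w_j)=\prod_{j=1}^k a(v_j,w_j)$. Let $\mathcal{M}(k)$ be the set of pair partitions of $\{1,\dots,k\}$ (empty if $k$ is odd), each written as a set of ordered pairs $\mathfrak{m}=\{(m_\nu,n_\nu):\nu=1,\dots,l\}$ with $m_\nu<n_\nu$, where $k=2l$. For $\mathfrak{m}\in\mathcal{M}(k)$ put $$\theta_{\mathfrak{m}}=\sum_{\eta:\{1,\dots,l\}\to\{1,\dots,n\}}\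 \sum_{\varepsilon:\{1,\dots,l\}\to\{0,1\}}\ \bigotimes_{j=1}^{k} v(\eta,\varepsilon,j),\qquad v(\eta,\varepsilon,j)=\begin{cases} e_{\eta(\nu)+n\varepsilon(\nu)}, & j=m_\nu,\\ (-1)^{\varepsilon(\nu)}\,e_{\eta(\nu)+n(1-\varepsilon(\nu))}, & j=n_\nu.\end{cases}$$ The symplectic Weingarten function $\mathrm{Wg}_{\mathrm{Sp}_{2n}}(\mathfrak{m},\mathfrak{m}')$ is the $(\mathfrak{m},\mathfrak{m}')$-entry of the inverse of the Gram matrix $\bigl(a(\theta_{\mathfrak{m}},\theta_{\mathfrak{m}'})\bigr)_{\mathfrak{m},\mathfrak{m}'\in\mathcal{M}(k)}$; when this matrix is singular (which can happen only for $n<l$), the inverse is understood as the Moore–Penrose inverse. For $\varphi:\{1,\dots,k\}\to\{1,\dots,n\}$ and $\alpha:\{1,\dots,k\}\to\{0,1\}$, write $\varphi+n\alpha\in\mathcal{F}(\mathfrak{m},2n)$ if $\varphi(m_\nu)=\varphi(n_\nu)$ and $\{\alpha(m_\nu),\alpha(n_\nu)\}=\{0,1\}$ for all $\nu$. **Proposition.**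 Let $\varphi,\psi:\{1,\dots,k\}\to\{1,\dots,n\}$ and $\alpha,\beta:\{1,\dots,k\}\to\{0,1\}$. Then $$\int_{\mathrm{Sp}_{2n}}\prod_{j=1}^{k} g_{\varphi(j)+n\alpha(j),\,\psi(j)+n\beta(j)}\ \lambda_{\mathrm{Sp}_{2n}}(dg)=\sum_{\mathfrak{m},\mathfrak{m}'\in\mathcal{M}(k)}\mathrm{Wg}_{\mathrm{Sp}_{2n}}(\mathfrak{m},\mathfrak{m}')\,(-1)^{\#\{\nu:\,\alpha(m_\nu)=0\}+\#\{\nu:\,\beta(m'_\nu)=0\}}\,1_{\mathcal{F}(\mathfrak{m},2n)}(\varphi+n\alpha)\,1_{\mathcal{F}(\mathfrak{m}',2n)}(\psi+n\beta),$$ where $\mathfrak{m}=\{(m_\nu,n_\nu)\}$ and $\mathfrak{m}'=\{(m'_\nu,n'_\nu)\}$. In particular the integral vanishes if $k$ is odd. -/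

import Mathlib

open MeasureTheory

namespace SymplecticWeingarten

noncomputable section

/-! ### The compact symplectic group and its Haar probability measure

The `2n` basis indices are modelled by `Fin n ⊕ Fin n`: `Sum.inl i` is the index `i` and
`Sum.inr i` is the index `n + i`. -/

/-- The set of quaternionic matrices `[[X, Y], [-conj Y, conj X]]` inside the complex
`2n × 2n` matrices. -/
def quaternionic (n : ℕ) : Set (Matrix (Fin n ⊕ Fin n) (Fin n ⊕ Fin n) ℂ) :=
  {g | ∃ X Y : Matrix (Fin n) (Fin n) ℂ,
    g = Matrix.fromBlocks X Y (-(Y.map (starRingEnd ℂ))) (X.map (starRingEnd ℂ))}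

/-- The compact symplectic group `Sp_{2n}`: the unitary quaternionic matrices. -/
def Sp (n : ℕ) : Subgroup (Matrix.unitaryGroup (Fin n ⊕ Fin n) ℂ) where
  carrier := {g | (g : Matrix (Fin n ⊕ Fin n) (Fin n ⊕ Fin n) ℂ) ∈ quaternionic n}
  one_mem' := by
    refine ⟨1, 0, ?_⟩
    ext i j
    rcases i with i | i <;> rcases j with j | j <;>
      simp [Matrix.one_apply, apply_ite]
  mul_mem' := by
    rintro g h ⟨X, Y, hg⟩ ⟨X', Y', hh⟩
    refine ⟨X * X' - Y * Y'.map (starRingEnd ℂ), X * Y' + Y * X'.map (starRingEnd ℂ), ?_⟩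
    rw [Matrix.UnitaryGroup.mul_val, hg, hh, Matrix.fromBlocks_multiply]
    ext i j
    rcases i with i | i <;> rcases j with j | j <;>
      simp [Matrix.mul_apply, sub_eq_add_neg, add_comm]
  inv_mem' := by
    rintro g ⟨X, Y, hg⟩
    refine ⟨X.conjTranspose, -Y.transpose, ?_⟩
    rw [Matrix.UnitaryGroup.inv_val, hg]
    ext i j
    rcases i with i | i <;> rcases j with j | j <;>
      simp [Matrix.conjTranspose_apply]

instance (n : ℕ) : MeasurableSpace (Sp n) := borel _

instance (n : ℕ) : BorelSpace (Sp n) := ⟨rfl⟩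

instance (n : ℕ) : CompactSpace (Sp n) := by
  let v : Sp n → Matrix (Fin n ⊕ Fin n) (Fin n ⊕ Fin n) ℂ := fun g => g.1.1
  have hv : Topology.IsEmbedding v :=
    Topology.IsEmbedding.subtypeVal.comp Topology.IsEmbedding.subtypeVal
  have hrange : Set.range v =
      {A | A ∈ Matrix.unitaryGroup (Fin n ⊕ Fin n) ℂ} ∩ {A | A = Matrix.fromBlocks A.toBlocks₁₁
        A.toBlocks₁₂ (-(A.toBlocks₁₂.map (starRingEnd ℂ)))
        (A.toBlocks₁₁.map (starRingEnd ℂ))} := by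
    ext A
    constructor
    · rintro ⟨g, rfl⟩
      refine ⟨g.1.2, ?_⟩
      obtain ⟨X, Y, h⟩ := g.2
      have h' : v g = _ := h
      change v g = Matrix.fromBlocks _ _ _ _
      rw [h']
      simp
    · rintro ⟨h1, h2⟩
      exact ⟨⟨⟨A, h1⟩, ⟨_, _, h2⟩⟩, rfl⟩
  have hclosed : IsClosed (Set.range v) := by
    rw [hrange]
    refine IsClosed.inter ?_ ?_
    · have : {A | A ∈ Matrix.unitaryGroup (Fin n ⊕ Fin n) ℂ} =
          {A : Matrix (Fin n ⊕ Fin n) (Fin n ⊕ Fin n) ℂ | A * star A = 1} := by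
        ext A
        exact Matrix.mem_unitaryGroup_iff
      rw [this]
      exact isClosed_eq (by fun_prop) continuous_const
    · refine isClosed_eq continuous_id ?_
      refine Continuous.matrix_fromBlocks ?_ ?_ ?_ ?_
      · exact continuous_matrix fun i j => by
          simpa [Matrix.toBlocks₁₁] using continuous_id.matrix_elem (Sum.inl i) (Sum.inl j)
      · exact continuous_matrix fun i j => by
          simpa [Matrix.toBlocks₁₂] using continuous_id.matrix_elem (Sum.inl i) (Sum.inr j)
      · exact continuous_matrix fun i j => 
          (Complex.continuous_conj.comp
            (continuous_id.matrix_elem (Sum.inl i) (Sum.inr j))).neg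
      · exact continuous_matrix fun i j => 
          Complex.continuous_conj.comp (continuous_id.matrix_elem (Sum.inl i) (Sum.inl j))
  have hcompact : IsCompact (Set.range v) := by
    have hbox : IsCompact (Set.univ.pi fun _ => Set.univ.pi fun _ => Metric.closedBall 0 1 :
        Set (Fin n ⊕ Fin n → Fin n ⊕ Fin n → ℂ)) :=
      isCompact_univ_pi fun _ => isCompact_univ_pi fun _ => isCompact_closedBall _ _
    refine IsCompact.of_isClosed_subset hbox hclosed ?_
    rintro _ ⟨g, rfl⟩ i _ j _
    rw [mem_closedBall_zero_iff]
    exact entry_norm_bound_of_unitary g.1.2 i j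
  exact ⟨hv.isCompact_iff.2 (by simpa using hcompact)⟩

/-- Haar measure on `Sp_{2n}`, normalized to total mass one. -/
def haarSp (n : ℕ) : Measure (Sp n) :=
  Measure.haarMeasure ⊤

/-! ### Tensor powers of `V = ℂ^{2n}`, in coordinates -/

/-- The space `V = ℂ^{2n}`. -/
abbrev V (n : ℕ) : Type := Fin n ⊕ Fin n → ℂ

/-- The index `i + n * s` for `i ∈ {1, …, n}` and `s ∈ {0, 1}`. -/
def idx {n : ℕ} (i : Fin n) (s : Fin 2) : Fin n ⊕ Fin n :=
  if s = 0 then Sum.inl i else Sum.inr i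

/-- The basis vector `e_x` of `V`. -/
def e {n : ℕ} (x : Fin n ⊕ Fin n) : V n := Pi.single x 1

/-- The skew-symmetric bilinear form `a` on `V`: `a(e_i, e_{n+i}) = 1 = -a(e_{n+i}, e_i)`, all
other pairs of basis vectors giving `0`. -/
def symplForm {n : ℕ} (u w : V n) : ℂ :=
  ∑ i : Fin n, (u (Sum.inl i) * w (Sum.inr i) - u (Sum.inr i) * w (Sum.inl i))

/-- The tensor power `V^{⊗k}`; a tensor is given by its coordinates in the basis
`e_{f(1)} ⊗ ⋯ ⊗ e_{f(k)}`, where `f : {1, …, k} → {1, …, 2n}`. -/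
abbrev TensorPower (n k : ℕ) : Type := (Fin k → Fin n ⊕ Fin n) → ℂ

/-- The elementary tensor `v_1 ⊗ ⋯ ⊗ v_k`. -/
def pureTensor {n k : ℕ} (v : Fin k → V n) : TensorPower n k :=
  fun f => ∏ j, v j (f j)

/-- The bilinear extension of the form `a` to `V^{⊗k}`, determined by
`a(v_1 ⊗ ⋯ ⊗ v_k, w_1 ⊗ ⋯ ⊗ w_k) = ∏ j, a(v_j, w_j)` on (basis) elementary tensors. -/
def tensorForm {n k : ℕ} (S T : TensorPower n k) : ℂ :=
  ∑ f : Fin k → Fin n ⊕ Fin n, ∑ g : Fin k → Fin n ⊕ Fin n,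
    S f * T g * ∏ j, symplForm (e (f j)) (e (g j))

/-! ### Pair partitions -/

/-- The pair partitions of `{1, …, k}`, each block `{m_ν, n_ν}` being written as the ordered pair
`(m_ν, n_ν)` with `m_ν < n_ν`. There are none if `k` is odd. -/
def PairPartition (k : ℕ) : Type :=
  {P : Finset (Fin k × Fin k) // (∀ p ∈ P, p.1 < p.2) ∧
    ∀ j : Fin k, ∃! p : Fin k × Fin k, p ∈ P ∧ (j = p.1 ∨ j = p.2)}

/-- The set of ordered pairs `(m_ν, n_ν)` of a pair partition. -/
def PairPartition.pairs {k : ℕ} (m : PairPartition k) : Finset (Fin k × Fin k) := m.1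

instance (k : ℕ) : Finite (PairPartition k) :=
  inferInstanceAs (Finite {P : Finset (Fin k × Fin k) // (∀ p ∈ P, p.1 < p.2) ∧
    ∀ j : Fin k, ∃! p : Fin k × Fin k, p ∈ P ∧ (j = p.1 ∨ j = p.2)})

instance (k : ℕ) : Fintype (PairPartition k) := Fintype.ofFinite _

/-- The pair of the partition that contains `j`. -/
def PairPartition.pairOf {k : ℕ} (m : PairPartition k) (j : Fin k) : m.pairs :=
  ⟨(m.2.2 j).choose, (m.2.2 j).choose_spec.1.1⟩

/-- The vector `v(η, ε, j)`: if `ν` is the pair containing `j`, it is `e_{η(ν) + n ε(ν)}` when `j`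
is the first element of that pair and `(-1)^{ε(ν)} e_{η(ν) + n (1 - ε(ν))}` when `j` is the
second one. -/
def thetaVec {n k : ℕ} (m : PairPartition k) (η : m.pairs → Fin n) (ε : m.pairs → Fin 2)
    (j : Fin k) : V n :=
  if j = (m.pairOf j).1.1 then
    e (idx (η (m.pairOf j)) (ε (m.pairOf j)))
  else
    (-1 : ℂ) ^ (ε (m.pairOf j) : ℕ) • e (idx (η (m.pairOf j)) (1 - ε (m.pairOf j)))

/-- The invariant tensor `θ_m ∈ V^{⊗k}` attached to a pair partition `m`. -/
def theta (n : ℕ) {k : ℕ} (m : PairPartition k) : TensorPower n k :=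
  ∑ η : m.pairs → Fin n, ∑ ε : m.pairs → Fin 2, pureTensor (thetaVec m η ε)

/-- The set `F(m, 2n)` of all functions `φ + nα` such that `φ` is constant on the blocks of `m`
and `α` takes both values `0` and `1` on each block of `m`. -/
def F (n : ℕ) {k : ℕ} (m : PairPartition k) : Set (Fin k → Fin n ⊕ Fin n) :=
  {f | ∃ (φ : Fin k → Fin n) (α : Fin k → Fin 2), (f = fun j => idx (φ j) (α j)) ∧
    (∀ p ∈ m.pairs, φ p.1 = φ p.2) ∧
    (∀ p ∈ m.pairs, ({α p.1, α p.2} : Set (Fin 2)) = {0, 1})}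

/-! ### The Moore–Penrose inverse -/

/-- `B` is the Moore–Penrose inverse of `A`. -/
def IsMoorePenrose {ι : Type*} [Fintype ι] (A B : Matrix ι ι ℂ) : Prop :=
  A * B * A = A ∧ B * A * B = B ∧
    (A * B).conjTranspose = A * B ∧ (B * A).conjTranspose = B * A

theorem exists_isMoorePenrose_of_isHermitian {ι : Type*} [Fintype ι] {H : Matrix ι ι ℂ}
    (hH : H.IsHermitian) :
    ∃ K : Matrix ι ι ℂ, K.IsHermitian ∧ H * K = K * H ∧ H * K * H = H ∧ K * H * K = K := by
  classical
  obtain ⟨U, d, hs⟩ : ∃ (U : Matrix.unitaryGroup ι ℂ) (d : ι → ℝ), H = (U : Matrix ι ι ℂ) *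
      Matrix.diagonal (fun i => (d i : ℂ)) * star (U : Matrix ι ι ℂ) := by
    have := hH.spectral_theorem
    rw [Unitary.conjStarAlgAut_apply] at this
    exact ⟨_, _, this⟩
  have hUU : star (U : Matrix ι ι ℂ) * (U : Matrix ι ι ℂ) = 1 := Matrix.mem_unitaryGroup_iff'.1 U.2
  have mulD : ∀ d d' : ι → ℂ, (U : Matrix ι ι ℂ) * Matrix.diagonal d * star (U : Matrix ι ι ℂ) *
      ((U : Matrix ι ι ℂ) * Matrix.diagonal d' * star (U : Matrix ι ι ℂ)) =
      (U : Matrix ι ι ℂ) * Matrix.diagonal (fun i => d i * d' i) * star (U : Matrix ι ι ℂ) := by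
    intro d d'
    rw [← Matrix.diagonal_mul_diagonal]
    calc _ = (U : Matrix ι ι ℂ) * Matrix.diagonal d * (star (U : Matrix ι ι ℂ) *
          (U : Matrix ι ι ℂ)) * Matrix.diagonal d' * star (U : Matrix ι ι ℂ) := by
            simp only [mul_assoc]
      _ = _ := by rw [hUU, mul_one]; simp only [mul_assoc]
  refine ⟨(U : Matrix ι ι ℂ) * Matrix.diagonal (fun i => ((d i : ℂ))⁻¹) *
    star (U : Matrix ι ι ℂ), ?_, ?_, ?_, ?_⟩
  · rw [Matrix.IsHermitian, Matrix.star_eq_conjTranspose, Matrix.conjTranspose_mul,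
      Matrix.conjTranspose_mul, Matrix.conjTranspose_conjTranspose, Matrix.diagonal_conjTranspose,
      ← mul_assoc]
    congr 3
    ext i
    simp
  · rw [hs, mulD, mulD]
    simp only [mul_comm]
  · rw [hs, mulD, mulD]
    congr 3
    ext i
    by_cases h : (d i : ℂ) = 0
    · simp [h]
    · field_simp
  · rw [hs, mulD, mulD]
    congr 3
    ext i
    by_cases h : (d i : ℂ) = 0
    · simp [h]
    · field_simp

theorem exists_isMoorePenrose {ι : Type*} [Fintype ι] (A : Matrix ι ι ℂ) :
    ∃ B, IsMoorePenrose A B := by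
  classical
  obtain ⟨K, hK, hcomm, h1, h2⟩ :=
    exists_isMoorePenrose_of_isHermitian (Matrix.isHermitian_conjTranspose_mul_self A)
  have hA : A * K * (A.conjTranspose * A) = A := by
    have hz : (A * K * (A.conjTranspose * A) - A).conjTranspose *
        (A * K * (A.conjTranspose * A) - A) = 0 := by
      have h0 : A.conjTranspose * (A * K * (A.conjTranspose * A) - A) = 0 := by
        rw [mul_sub, sub_eq_zero]
        simpa only [mul_assoc] using h1
      have : A * K * (A.conjTranspose * A) - A = A * (K * (A.conjTranspose * A) - 1) := by
        rw [mul_sub, mul_one, mul_assoc]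
      nth_rw 1 [this]
      rw [Matrix.conjTranspose_mul, mul_assoc, h0, mul_zero]
    open scoped ComplexOrder in
    exact sub_eq_zero.1 (Matrix.conjTranspose_mul_self_eq_zero.1 hz)
  refine ⟨K * A.conjTranspose, ?_, ?_, ?_, ?_⟩
  · simpa only [mul_assoc] using hA
  · have := congrArg (· * A.conjTranspose) h2
    simpa only [mul_assoc] using this
  · simp only [Matrix.conjTranspose_mul, Matrix.conjTranspose_conjTranspose, hK.eq, mul_assoc]
  · rw [mul_assoc, Matrix.conjTranspose_mul, hK.eq, Matrix.conjTranspose_mul,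
      Matrix.conjTranspose_conjTranspose, hcomm]

/-- The Moore–Penrose inverse of a square complex matrix. -/
def moorePenrose {ι : Type*} [Fintype ι] (A : Matrix ι ι ℂ) : Matrix ι ι ℂ :=
  (exists_isMoorePenrose A).choose

/-- For an invertible matrix the Moore–Penrose inverse is the inverse. -/
theorem moorePenrose_eq_inv {ι : Type*} [Fintype ι] [DecidableEq ι] (A : Matrix ι ι ℂ)
    (hA : IsUnit A.det) : moorePenrose A = A⁻¹ := by
  have h := (exists_isMoorePenrose A).choose_spec.1
  calc moorePenrose A = A⁻¹ * (A * moorePenrose A * A) * A⁻¹ := by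
        rw [mul_assoc A, ← mul_assoc, Matrix.nonsing_inv_mul _ hA, one_mul, mul_assoc,
          Matrix.mul_nonsing_inv _ hA, mul_one]
    _ = A⁻¹ * A * A⁻¹ := by rw [moorePenrose, h]
    _ = A⁻¹ := by rw [Matrix.nonsing_inv_mul _ hA, one_mul]

/-! ### The symplectic Weingarten function -/

/-- The Gram matrix `c(m, m') = a(θ_m, θ_{m'})`. -/
def gram (n k : ℕ) : Matrix (PairPartition k) (PairPartition k) ℂ :=
  Matrix.of fun m m' => tensorForm (theta n m) (theta n m')

/-- The symplectic Weingarten function: the inverse of the Gram matrix when the latter is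
invertible (see `moorePenrose_eq_inv`), which is the case for `2 * n ≥ k`, and its Moore–Penrose
inverse for general `n`. -/
def Wg (n k : ℕ) : Matrix (PairPartition k) (PairPartition k) ℂ :=
  moorePenrose (gram n k)

end

end SymplecticWeingarten

/-! Let J be the matrix of the form. In coordinates, θ_m is the function f ↦ ∏ J(f(p.1), f(p.2))
over the pairs p of m (`theta_apply`). Fix the column multi-index h. By translation invariance of
Haar measure the moments, as a function of the row multi-index, form an Sp-invariant tensor. Pairing
this tensor with θ_m returns θ_m(h), because transposes of group elements preserve J as well. Once
the θ_m are known to span the invariants, only linear algebra remains: the coefficients of the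
moment tensor solve a Gram system. The Moore–Penrose inverse solves it even when it is singular,
since the Gram matrix is T Tᴴ, where T has the real rows θ_m.

The spanning statement is the first fundamental theorem, used in the form
`IsInvariant.eq_zero_of_orthogonal`: an invariant tensor orthogonal to every θ_m is zero. Induction
on the number of slots kills all contractions with J, so the tensor v is traceless. The complexified
Lie algebra contains all SJ with S symmetric. Applied to a traceless v, its action becomes (2n+1) v
+ ∑_{i≠j} v∘(i j) = 0 for each slot j. No nonzero tensor on 2n letters satisfies this
(`IsTranspositionEigenvector.eq_zero`). To see it, pass to a nonzero solution w antisymmetric on a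
set S of slots of maximal size. Then |S| ≤ 2n, and adding the relations over S gives (|S|(2n+2-|S|)
+ |Sᶜ|) w = 0 with a positive coefficient. -/

namespace SymplecticWeingarten

/-! ### Tensors annihilated by all shifted Jucys–Murphy elements -/

section Antisymmetry

variable {ι X : Type*} [DecidableEq ι]

/-- At a point f of the support, two slots of S with equal letters would give v f = -v f; hence f is
injective on S. -/
theorem card_le_card_of_antisymmetric [Fintype X] {S : Finset ι} {v : (ι → X) → ℂ} (hv : v ≠ 0)
    (h : ∀ i ∈ S, ∀ j ∈ S, i ≠ j → ∀ f, v (f ∘ Equiv.swap i j) = -v f) :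
    S.card ≤ Fintype.card X := by
  obtain ⟨f, hf⟩ := Function.ne_iff.1 hv
  refine Finset.card_le_card_of_injOn f (fun _ _ => Finset.mem_univ _) ?_
  intro i hi j hj hij
  by_contra hne
  have e : f ∘ Equiv.swap i j = f := by
    funext l
    simp only [Function.comp_apply, Equiv.swap_apply_def]
    split_ifs with h1 h2
    · rw [h1, hij]
    · rw [h2, hij]
    · rfl
  have := h i hi j hj hne f
  rw [e] at this
  exact hf (self_eq_neg.1 this)

/-- For every slot `j`, the tensor `v` is an eigenvector with eigenvalue `-c` of the sum of all
transpositions moving `j`. -/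
def IsTranspositionEigenvector [Fintype ι] (c : ℂ) (v : (ι → X) → ℂ) : Prop :=
  ∀ (j : ι) (f : ι → X), c * v f + ∑ i ∈ Finset.univ.erase j, v (f ∘ Equiv.swap i j) = 0

/-- Conjugation by σ carries the transpositions moving j to those moving σ⁻¹ j, so the family of
relations over all slots is stable. -/
theorem IsTranspositionEigenvector.comp_perm [Fintype ι] {c : ℂ} {v : (ι → X) → ℂ}
    (hv : IsTranspositionEigenvector c v) (σ : Equiv.Perm ι) :
    IsTranspositionEigenvector c fun f => v (f ∘ σ) := by
  intro j f
  have := hv (σ⁻¹ j) (f ∘ σ)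
  rw [← this]
  congr 1
  refine Finset.sum_equiv σ⁻¹ (fun i => by simp) fun i _ => ?_
  change v _ = v _
  congr 1
  funext l
  simp only [Function.comp_apply]
  congr 1
  rw [Equiv.swap_apply_apply σ⁻¹ i j]
  simp

theorem IsTranspositionEigenvector.sub [Fintype ι] {c : ℂ} {v w : (ι → X) → ℂ}
    (hv : IsTranspositionEigenvector c v) (hw : IsTranspositionEigenvector c w) :
    IsTranspositionEigenvector c fun f => v f - w f := by
  intro j f
  have h1 := hv j f
  have h2 := hw j f
  simp only [Finset.sum_sub_distrib]
  linear_combination h1 - h2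

theorem IsTranspositionEigenvector.sum [Fintype ι] {α : Type*} {c : ℂ} (s : Finset α)
    {v : α → (ι → X) → ℂ} (hv : ∀ a ∈ s, IsTranspositionEigenvector c (v a)) :
    IsTranspositionEigenvector c fun f => ∑ a ∈ s, v a f := by
  intro j f
  rw [Finset.sum_comm, Finset.mul_sum, ← Finset.sum_add_distrib]
  exact Finset.sum_eq_zero fun a ha => hv a ha j f

/-- Antisymmetrising in one further slot. -/
theorem antisymmetric_insert {S : Finset ι} {v : (ι → X) → ℂ}
    (h : ∀ i ∈ S, ∀ j ∈ S, i ≠ j → ∀ f, v (f ∘ Equiv.swap i j) = -v f) {j : ι} (hj : j ∉ S) :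
    ∀ a ∈ insert j S, ∀ b ∈ insert j S, a ≠ b → ∀ f : ι → X,
      (v (f ∘ Equiv.swap a b) - ∑ i ∈ S, v (f ∘ Equiv.swap a b ∘ Equiv.swap i j)) =
        -(v f - ∑ i ∈ S, v (f ∘ Equiv.swap i j)) := by
  -- Swapping with the new slot: the term i = a is exchanged with the leading v f, and the others
  -- change sign because (a j)(i j) = (i j)(a i) with a, i ∈ S.
  have key : ∀ a ∈ S, ∀ f : ι → X,
      (v (f ∘ Equiv.swap a j) - ∑ i ∈ S, v (f ∘ Equiv.swap a j ∘ Equiv.swap i j)) =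
        -(v f - ∑ i ∈ S, v (f ∘ Equiv.swap i j)) := by
    intro a ha f
    rw [← Finset.add_sum_erase _ _ ha, ← Finset.add_sum_erase _ _ ha]
    have e1 : f ∘ Equiv.swap a j ∘ Equiv.swap a j = f := by
      funext l
      simp
    have e2 : ∑ i ∈ S.erase a, v (f ∘ Equiv.swap a j ∘ Equiv.swap i j) =
        -∑ i ∈ S.erase a, v (f ∘ Equiv.swap i j) := by
      rw [← Finset.sum_neg_distrib]
      refine Finset.sum_congr rfl fun i hi => ?_
      obtain ⟨hia, hi⟩ := Finset.mem_erase.1 hi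
      rw [← h a ha i hi (Ne.symm hia)]
      congr 1
      have hij : i ≠ j := fun e => hj (e ▸ hi)
      have haj : a ≠ j := fun e => hj (e ▸ ha)
      funext l
      simp only [Function.comp_apply]
      congr 1
      simp only [Equiv.swap_apply_def]
      grind
    rw [e1, e2]
    ring
  intro a ha b hb hab f
  rcases Finset.mem_insert.1 ha with rfl | ha
  · rcases Finset.mem_insert.1 hb with rfl | hb
    · exact absurd rfl hab
    · rw [Equiv.swap_comm]
      exact key b hb f
  · rcases Finset.mem_insert.1 hb with hbj | hb
    · rw [hbj]
      exact key a ha f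
    -- Both slots are old: conjugation by (a b) fixes j and merely permutes the summation index in
    -- S.
    · have e : ∑ i ∈ S, v (f ∘ Equiv.swap a b ∘ Equiv.swap i j) =
          ∑ i ∈ S, -v (f ∘ Equiv.swap i j) := by
        refine Finset.sum_equiv (Equiv.swap a b) (fun i => ?_) fun i _ => ?_
        · rw [Equiv.swap_apply_def]
          split_ifs with h1 h2
          · simp [h1, ha, hb]
          · simp [h2, ha, hb]
          · rfl
        · rw [← h a ha b hb hab]
          congr 1
          have haj : a ≠ j := fun e => hj (e ▸ ha)
          have hbj : b ≠ j := fun e => hj (e ▸ hb)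
          funext l
          simp only [Function.comp_apply]
          congr 1
          have := Equiv.swap_apply_apply (Equiv.swap a b) i j
          rw [Equiv.swap_apply_of_ne_of_ne haj.symm hbj.symm] at this
          simp [this]
      rw [e, h a ha b hb hab, Finset.sum_neg_distrib]
      ring

theorem IsTranspositionEigenvector.eq_zero [Fintype ι] [Fintype X] [Nonempty ι] {v : (ι → X) → ℂ}
    (hv : IsTranspositionEigenvector ((Fintype.card X : ℂ) + 1) v) : v = 0 := by
  classical
  by_contra hv0
  let good : Finset (Finset ι) := Finset.univ.filter fun S => ∃ w : (ι → X) → ℂ, w ≠ 0 ∧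
    IsTranspositionEigenvector ((Fintype.card X : ℂ) + 1) w ∧
    ∀ i ∈ S, ∀ j ∈ S, i ≠ j → ∀ f, w (f ∘ Equiv.swap i j) = -w f
  have hgood : ∀ i : ι, {i} ∈ good := fun i => by
    refine Finset.mem_filter.2 ⟨Finset.mem_univ _, v, hv0, hv, ?_⟩
    intro a ha b hb hab
    rw [Finset.mem_singleton] at ha hb
    exact absurd (ha.trans hb.symm) hab
  obtain ⟨i₀⟩ := ‹Nonempty ι›
  obtain ⟨S, hS, hmax⟩ := Finset.exists_max_image good Finset.card ⟨_, hgood i₀⟩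
  have hpos : 1 ≤ S.card := by simpa using hmax _ (hgood i₀)
  obtain ⟨-, w, hw0, hw, hanti⟩ := Finset.mem_filter.1 hS
  have hcard := card_le_card_of_antisymmetric hw0 hanti
  -- By maximality of S, antisymmetrising w in one more slot must give zero; otherwise the result
  -- would be a solution for `insert j S`.
  have hout : ∀ j ∉ S, ∀ f, ∑ i ∈ S, w (f ∘ Equiv.swap i j) = w f := by
    intro j hj
    by_contra! hne
    obtain ⟨f, hf⟩ := hne
    have : insert j S ∈ good := by
      refine Finset.mem_filter.2 ⟨Finset.mem_univ _,
        fun f => w f - ∑ i ∈ S, w (f ∘ Equiv.swap i j), ?_, ?_, ?_⟩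
      · exact fun h0 => hf (sub_eq_zero.1 (congrFun h0 f)).symm
      · exact hw.sub (IsTranspositionEigenvector.sum S fun i _ => hw.comp_perm _)
      · exact antisymmetric_insert hanti hj
    have := hmax _ this
    rw [Finset.card_insert_of_notMem hj] at this
    omega
  obtain ⟨f, hf⟩ := Function.ne_iff.1 hw0
  -- The double sum is evaluated twice: by the eigenvector relation here, and below by antisymmetry
  -- inside S together with `hout` outside S.
  have hsum : ∑ i ∈ S, ∑ j ∈ Finset.univ.erase i, w (f ∘ Equiv.swap j i) =
      -(S.card * ((Fintype.card X : ℂ) + 1) * w f) := by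
    have : ∀ i ∈ S, ∑ j ∈ Finset.univ.erase i, w (f ∘ Equiv.swap j i) =
        -(((Fintype.card X : ℂ) + 1) * w f) := fun i _ => by
      linear_combination hw i f
    rw [Finset.sum_congr rfl this]
    simp
    ring
  have hsplit : ∀ i ∈ S, ∑ j ∈ Finset.univ.erase i, w (f ∘ Equiv.swap j i) =
      -((S.card : ℂ) - 1) * w f + ∑ j ∈ Sᶜ, w (f ∘ Equiv.swap i j) := by
    intro i hi
    have hu : Finset.univ.erase i = S.erase i ∪ Sᶜ := by
      ext l
      by_cases hl : l ∈ S <;> simp [hl]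
      rintro rfl
      exact hl hi
    have hd : Disjoint (S.erase i) Sᶜ :=
      Finset.disjoint_of_subset_left (Finset.erase_subset _ _) disjoint_compl_right
    rw [hu, Finset.sum_union hd]
    congr 1
    · rw [Finset.sum_congr rfl (g := fun _ => -w f)]
      · rw [Finset.sum_const, Finset.card_erase_of_mem hi, nsmul_eq_mul, Nat.cast_sub hpos]
        push_cast
        ring
      · intro j hj
        obtain ⟨hji, hj⟩ := Finset.mem_erase.1 hj
        exact hanti j hj i hi hji f
    · exact Finset.sum_congr rfl fun j _ => by rw [Equiv.swap_comm]
  rw [Finset.sum_congr rfl hsplit, Finset.sum_add_distrib, Finset.sum_comm (s := S),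
    Finset.sum_congr rfl fun j hj => hout j (Finset.mem_compl.1 hj) f] at hsum
  simp only [Finset.sum_const, nsmul_eq_mul] at hsum
  -- `hcard` makes the natural subtraction exact and its value at least 2, so the coefficient cannot
  -- vanish.
  have hnat : ((S.card * (Fintype.card X + 2 - S.card) + Sᶜ.card : ℕ) : ℂ) * w f = 0 := by
    rw [Nat.cast_add, Nat.cast_mul, Nat.cast_sub (by omega)]
    push_cast
    linear_combination hsum
  rcases mul_eq_zero.1 hnat with h0 | h0
  · rw [Nat.cast_eq_zero] at h0
    have : 0 < S.card * (Fintype.card X + 2 - S.card) := Nat.mul_pos (by omega) (by omega)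
    omega
  · exact hf h0

end Antisymmetry

/-! ### The matrix of the symplectic form -/

/-- The matrix `a(e_x, e_y)` of the symplectic form. -/
def skew (n : ℕ) : Matrix (Fin n ⊕ Fin n) (Fin n ⊕ Fin n) ℂ :=
  Matrix.fromBlocks 0 1 (-1) 0

theorem skew_mul_skew (n : ℕ) : skew n * skew n = -1 := by
  rw [skew, Matrix.fromBlocks_multiply, ← Matrix.fromBlocks_one, Matrix.fromBlocks_neg]
  simp

theorem skew_transpose (n : ℕ) : (skew n).transpose = -skew n := by
  rw [skew, Matrix.fromBlocks_transpose, Matrix.fromBlocks_neg]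
  simp

theorem skew_apply_swap {n : ℕ} (x y : Fin n ⊕ Fin n) : skew n x y = -skew n y x :=
  congrFun (congrFun (skew_transpose n) y) x

theorem skew_map_conj (n : ℕ) : (skew n).map (starRingEnd ℂ) = skew n := by
  ext i j
  rcases i with i | i <;> rcases j with j | j <;>
    simp [skew, Matrix.one_apply, apply_ite]

theorem sum_skew_mul_skew {n : ℕ} (x y : Fin n ⊕ Fin n) :
    ∑ z, skew n x z * skew n z y = if x = y then -1 else 0 := by
  rw [← Matrix.mul_apply, skew_mul_skew, Matrix.neg_apply, Matrix.one_apply]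
  split_ifs <;> simp

/-- The block shape says that g commutes with the antilinear structure map u ↦ J ū. This form passes
easily to exponentials. -/
theorem mem_quaternionic_iff {n : ℕ} (g : Matrix (Fin n ⊕ Fin n) (Fin n ⊕ Fin n) ℂ) :
    g ∈ quaternionic n ↔ g * skew n = skew n * g.map (starRingEnd ℂ) := by
  constructor
  · rintro ⟨X, Y, rfl⟩
    rw [skew, Matrix.fromBlocks_map, Matrix.fromBlocks_multiply, Matrix.fromBlocks_multiply]
    ext i j
    rcases i with i | i <;> rcases j with j | j <;> simp
  · intro h
    rw [← Matrix.fromBlocks_toBlocks g, skew, Matrix.fromBlocks_map, Matrix.fromBlocks_multiply,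
      Matrix.fromBlocks_multiply, Matrix.fromBlocks_inj] at h
    obtain ⟨h1, h2, -, -⟩ := h
    refine ⟨g.toBlocks₁₁, g.toBlocks₁₂, ?_⟩
    conv_lhs => rw [← Matrix.fromBlocks_toBlocks g]
    simp only [mul_zero, zero_mul, mul_one, one_mul, zero_add, add_zero, mul_neg] at h1 h2
    rw [Matrix.fromBlocks_inj]
    refine ⟨rfl, rfl, ?_, ?_⟩
    · rw [← Matrix.map_neg _ (map_neg _), h1]
      ext i j
      simp
    · rw [h2]
      ext i j
      simp

theorem skew_mem_Sp (n : ℕ) : ∃ g : Sp n, g.1.1 = skew n := by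
  refine ⟨⟨⟨skew n, ?_⟩, ?_⟩, rfl⟩
  · rw [Matrix.mem_unitaryGroup_iff, Matrix.star_eq_conjTranspose, Matrix.conjTranspose]
    have : (skew n).transpose.map star = -skew n := by
      rw [skew_transpose, Matrix.map_neg _ (by simp)]
      exact congrArg _ (skew_map_conj n)
    rw [this, mul_neg, skew_mul_skew, neg_neg]
  · change skew n ∈ quaternionic n
    rw [mem_quaternionic_iff, skew_map_conj]

theorem Sp.mul_skew_mul_transpose {n : ℕ} (g : Sp n) :
    g.1.1 * skew n * g.1.1.transpose = skew n := by
  have h := (mem_quaternionic_iff g.1.1).1 g.2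
  have h1 : g.1.1 * g.1.1.conjTranspose = 1 := Matrix.mem_unitaryGroup_iff.1 g.1.2
  have h2 : g.1.1.map (starRingEnd ℂ) * g.1.1.transpose = 1 := by
    have := congrArg (fun A => A.map (starRingEnd ℂ)) h1
    simp only [Matrix.map_mul] at this
    convert this using 1
    · congr 1
      ext i j
      simp
    · ext i j
      simp [Matrix.one_apply, apply_ite]
  rw [h, mul_assoc, h2, mul_one]

theorem Sp.transpose_mul_skew_mul {n : ℕ} (g : Sp n) :
    g.1.1.transpose * skew n * g.1.1 = skew n := by
  -- The identity g J gᵀ = J exhibits a right inverse of g; for square matrices it is also a left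
  -- inverse.
  have h : g.1.1 * (-(skew n * g.1.1.transpose * skew n)) = 1 := by
    rw [mul_neg, ← mul_assoc, ← mul_assoc, Sp.mul_skew_mul_transpose, skew_mul_skew, neg_neg]
  have h2 := congrArg (fun A => skew n * A) (mul_eq_one_comm.1 h)
  simp only [neg_mul, mul_neg, ← mul_assoc, skew_mul_skew, one_mul, mul_one, neg_neg] at h2
  exact h2

/-! ### Invariant tensors and the infinitesimal action -/

section Invariant

variable {ι : Type*} [Fintype ι] [DecidableEq ι] {n : ℕ}

/-- Invariance of a tensor under the compact symplectic group. -/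
def IsInvariant (v : (ι → Fin n ⊕ Fin n) → ℂ) : Prop :=
  ∀ (g : Sp n) (f : ι → Fin n ⊕ Fin n), ∑ h, (∏ i, g.1.1 (f i) (h i)) * v h = v f

open Matrix.Norms.Operator in
theorem hasDerivAt_exp_smul_apply (A : Matrix (Fin n ⊕ Fin n) (Fin n ⊕ Fin n) ℂ)
    (x y : Fin n ⊕ Fin n) :
    HasDerivAt (fun t : ℝ => NormedSpace.exp (t • A) x y) (A x y) 0 := by
  have h := hasDerivAt_exp_smul_const (𝕂 := ℝ) A 0
  rw [zero_smul, NormedSpace.exp_zero, one_mul] at h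
  let L : Matrix (Fin n ⊕ Fin n) (Fin n ⊕ Fin n) ℂ →ₗ[ℝ] ℂ := Matrix.entryLinearMap ℝ ℂ x y
  exact (LinearMap.toContinuousLinearMap L).hasFDerivAt.comp_hasDerivAt (0 : ℝ) h

/-- The exponential of a skew-Hermitian matrix is unitary, and A = J Ā J⁻¹ exponentiates to the same
relation for exp A. -/
theorem exp_mem_Sp {A : Matrix (Fin n ⊕ Fin n) (Fin n ⊕ Fin n) ℂ} (hA : A.conjTranspose = -A)
    (hJ : A * skew n = skew n * A.map (starRingEnd ℂ)) :
    ∃ g : Sp n, g.1.1 = NormedSpace.exp A := by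
  have hdet : IsUnit (NormedSpace.exp A).det :=
    (Matrix.isUnit_iff_isUnit_det _).1 (Matrix.isUnit_exp A)
  refine ⟨⟨⟨NormedSpace.exp A, ?_⟩, ?_⟩, rfl⟩
  · rw [Matrix.mem_unitaryGroup_iff, Matrix.star_eq_conjTranspose, ← Matrix.exp_conjTranspose, hA,
      Matrix.exp_neg, Matrix.mul_nonsing_inv _ hdet]
  · change NormedSpace.exp A ∈ quaternionic n
    have hunit : IsUnit (skew n) :=
      IsUnit.of_mul_eq_one (-skew n) (by rw [mul_neg, skew_mul_skew, neg_neg])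
    have hdetJ := (Matrix.isUnit_iff_isUnit_det _).1 hunit
    have hA' : A = skew n * A.map (starRingEnd ℂ) * (skew n)⁻¹ := by
      rw [← hJ, Matrix.mul_nonsing_inv_cancel_right _ _ hdetJ]
    have hconj : (NormedSpace.exp A).map (starRingEnd ℂ) =
        NormedSpace.exp (A.map (starRingEnd ℂ)) := by
      have h1 : (NormedSpace.exp A).map (starRingEnd ℂ) =
        (NormedSpace.exp A).conjTranspose.transpose := rfl
      have h2 : A.map (starRingEnd ℂ) = A.conjTranspose.transpose := rfl
      rw [h1, h2, Matrix.exp_transpose, Matrix.exp_conjTranspose]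
    rw [mem_quaternionic_iff, hconj]
    conv_lhs => rw [hA', Matrix.exp_conj _ _ hunit]
    rw [Matrix.nonsing_inv_mul_cancel_right _ _ hdetJ]

/-- Summing against a tensor with a Kronecker delta in all slots but one. -/
theorem sum_prod_erase_ite_mul {X : Type*} [Fintype X] [DecidableEq X] (v : (ι → X) → ℂ)
    (f : ι → X) (i : ι) (c : X → ℂ) :
    ∑ h : ι → X, (∏ j ∈ Finset.univ.erase i, if f j = h j then (1 : ℂ) else 0) * c (h i) * v h =
      ∑ y, c y * v (Function.update f i y) := by
  symm
  refine Finset.sum_of_injOn (fun y => Function.update f i y)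
    (fun y _ y' _ h => by simpa using congrFun h i)
    (fun _ _ => Finset.mem_coe.2 (Finset.mem_univ _)) ?_ ?_
  · intro h _ hh
    obtain ⟨j, hj, hne⟩ : ∃ j, j ≠ i ∧ f j ≠ h j := by
      by_contra! hcon
      refine hh ⟨h i, Finset.mem_coe.2 (Finset.mem_univ _), ?_⟩
      funext j
      by_cases hj : j = i
      · rw [hj]
        simp
      · simp [hj, hcon j hj]
    rw [Finset.prod_eq_zero (Finset.mem_erase.2 ⟨hj, Finset.mem_univ j⟩) (if_neg hne)]
    simp
  · intro y _
    rw [Finset.prod_eq_one]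
    · simp
    · intro j hj
      simp [(Finset.mem_erase.1 hj).1]

/-- Differentiate the invariance under exp(tA) at t = 0; by the product rule A acts on one slot at a
time. -/
theorem IsInvariant.sum_update_of_skewAdjoint {v : (ι → Fin n ⊕ Fin n) → ℂ} (hv : IsInvariant v)
    {A : Matrix (Fin n ⊕ Fin n) (Fin n ⊕ Fin n) ℂ} (hA : A.conjTranspose = -A)
    (hJ : A * skew n = skew n * A.map (starRingEnd ℂ)) (f : ι → Fin n ⊕ Fin n) :
    ∑ i, ∑ y, A (f i) y * v (Function.update f i y) = 0 := by
  have hconst : ∀ t : ℝ, ∑ h, (∏ i, NormedSpace.exp (t • A) (f i) (h i)) * v h = v f := by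
    intro t
    obtain ⟨g, hg⟩ := exp_mem_Sp (A := t • A) (by simp [hA])
      (by
        have : (t • A).map (starRingEnd ℂ) = t • A.map (starRingEnd ℂ) := by
          ext i j
          simp
        rw [this, Matrix.smul_mul, hJ, Matrix.mul_smul])
    rw [← hg]
    exact hv g f
  have hder : HasDerivAt (fun t : ℝ => ∑ h, (∏ i, NormedSpace.exp (t • A) (f i) (h i)) * v h)
      (∑ h, (∑ i, (∏ j ∈ Finset.univ.erase i, NormedSpace.exp ((0 : ℝ) • A) (f j) (h j)) •
        A (f i) (h i)) * v h) 0 :=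
    HasDerivAt.fun_sum fun h _ => (HasDerivAt.fun_finsetProd fun i _ =>
      hasDerivAt_exp_smul_apply A (f i) (h i)).mul_const (v h)
  rw [funext hconst] at hder
  have h0 := hder.unique (hasDerivAt_const 0 (v f))
  simp only [zero_smul, NormedSpace.exp_zero, Finset.sum_mul, smul_eq_mul, Matrix.one_apply] at h0
  rw [Finset.sum_comm] at h0
  simpa only [sum_prod_erase_ite_mul] using h0

/-- The infinitesimal action of `S * skew n` with `S` symmetric kills invariant tensors. -/
theorem IsInvariant.sum_update_of_isSymm {v : (ι → Fin n ⊕ Fin n) → ℂ} (hv : IsInvariant v)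
    {S : Matrix (Fin n ⊕ Fin n) (Fin n ⊕ Fin n) ℂ} (hS : S.IsSymm) (f : ι → Fin n ⊕ Fin n) :
    ∑ i, ∑ y, (S * skew n) (f i) y * v (Function.update f i y) = 0 := by
  have hJs : (skew n).conjTranspose = -skew n := by
    rw [Matrix.conjTranspose, skew_transpose, Matrix.map_neg _ (by simp)]
    exact congrArg _ (skew_map_conj n)
  have hSc : S.map (starRingEnd ℂ) = S.conjTranspose := by
    conv_lhs => rw [← hS.eq]
    rfl
  have hmapmul : ∀ B C : Matrix (Fin n ⊕ Fin n) (Fin n ⊕ Fin n) ℂ,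
      (B * C).map (starRingEnd ℂ) = B.map (starRingEnd ℂ) * C.map (starRingEnd ℂ) :=
    fun B C => Matrix.map_mul
  have hmm : (S.conjTranspose).map (starRingEnd ℂ) = S := by
    rw [← hSc]
    ext i j
    simp
  -- With M = SJ one has Mᴴ = -J Sᴴ, so A = M - Mᴴ and B = i(M + Mᴴ) are skew-Hermitian and M = (A -
  -- iB)/2. Both are compatible with J, so M acts by zero by complex linearity.
  set A := S * skew n + skew n * S.conjTranspose with hAdef
  set B := Complex.I • (S * skew n - skew n * S.conjTranspose) with hBdef
  have hJJ := skew_mul_skew n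
  have h1 := hv.sum_update_of_skewAdjoint (A := A)
    (by
      rw [hAdef, Matrix.conjTranspose_add, Matrix.conjTranspose_mul, Matrix.conjTranspose_mul,
        Matrix.conjTranspose_conjTranspose, hJs]
      simp)
    (by
      have : A.map (starRingEnd ℂ) = S.conjTranspose * skew n + skew n * S := by
        rw [hAdef, Matrix.map_add _ (by simp), hmapmul, hmapmul, hSc, skew_map_conj, hmm]
      rw [this, hAdef, add_mul, mul_add, mul_assoc, hJJ, ← mul_assoc, ← mul_assoc, hJJ]
      simp [add_comm]) f
  have h2 := hv.sum_update_of_skewAdjoint (A := B)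
    (by
      rw [hBdef, Matrix.conjTranspose_smul, Matrix.conjTranspose_sub, Matrix.conjTranspose_mul,
        Matrix.conjTranspose_mul, Matrix.conjTranspose_conjTranspose, hJs]
      ext i j
      simp
      ring)
    (by
      have : B.map (starRingEnd ℂ) = -Complex.I • (S.conjTranspose * skew n - skew n * S) := by
        have : B.map (starRingEnd ℂ) =
            -Complex.I • (S * skew n - skew n * S.conjTranspose).map (starRingEnd ℂ) := by
          ext i j
          simp [hBdef]
        rw [this, Matrix.map_sub _ (by simp), hmapmul, hmapmul, hSc, skew_map_conj, hmm]
      rw [this, hBdef, Matrix.smul_mul, Matrix.mul_smul, sub_mul, mul_sub, mul_assoc, hJJ,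
        ← mul_assoc, ← mul_assoc, hJJ]
      ext i j
      simp
      ring) f
  have hcomb : ∀ x y, (S * skew n) x y = 2⁻¹ * A x y - 2⁻¹ * Complex.I * B x y := by
    intro x y
    simp only [hAdef, hBdef, Matrix.add_apply, Matrix.smul_apply, Matrix.sub_apply, smul_eq_mul]
    linear_combination (2⁻¹ * ((S * skew n) x y - (skew n * S.conjTranspose) x y)) * Complex.I_sq
  calc _ = ∑ i, ∑ y, (2⁻¹ * (A (f i) y * v (Function.update f i y)) -
        2⁻¹ * Complex.I * (B (f i) y * v (Function.update f i y))) := by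
        refine Finset.sum_congr rfl fun i _ => Finset.sum_congr rfl fun y _ => ?_
        rw [hcomb]
        ring
    _ = 0 := by
        simp only [Finset.sum_sub_distrib, ← Finset.mul_sum, h1, h2]
        simp

/-- The infinitesimal invariance for the rank-two symmetric matrices `E_{pq} + E_{qp}`. -/
theorem IsInvariant.sum_update_skew {v : (ι → Fin n ⊕ Fin n) → ℂ} (hv : IsInvariant v)
    (p q : Fin n ⊕ Fin n) (f : ι → Fin n ⊕ Fin n) :
    ∑ i, ∑ y, ((if f i = p then skew n q y else 0) + (if f i = q then skew n p y else 0)) *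
      v (Function.update f i y) = 0 := by
  have h := hv.sum_update_of_isSymm (S := Matrix.single p q 1 + Matrix.single q p 1)
    (by
      rw [Matrix.IsSymm, Matrix.transpose_add, Matrix.transpose_single, Matrix.transpose_single,
        add_comm]) f
  refine Eq.trans ?_ h
  refine Finset.sum_congr rfl fun i _ => Finset.sum_congr rfl fun y _ => ?_
  congr 1
  rw [add_mul, Matrix.add_apply, Matrix.mul_apply, Matrix.mul_apply]
  simp [Matrix.single_apply, ite_and, eq_comm]

/-- All contractions of the tensor `v` with the symplectic form vanish. -/
def IsTraceless (v : (ι → Fin n ⊕ Fin n) → ℂ) : Prop :=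
  ∀ (i j : ι) (f : ι → Fin n ⊕ Fin n), i ≠ j →
    ∑ x, ∑ y, skew n x y * v (Function.update (Function.update f i x) j y) = 0

/-- Put r in slot j, apply the infinitesimal relation for (r, q), and sum over r and q against -J(f
j, q), which inverts J. Slot j contributes 2n + 1 copies of v f. A slot i ≠ j contributes the
swapped tensor and a contraction, which vanishes by tracelessness. -/
theorem IsInvariant.isTranspositionEigenvector {v : (ι → Fin n ⊕ Fin n) → ℂ} (hv : IsInvariant v)
    (ht : IsTraceless v) :
    IsTranspositionEigenvector ((Fintype.card (Fin n ⊕ Fin n) : ℂ) + 1) v := by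
  intro j f
  have hrel : ∑ i, ∑ r, ∑ q, ∑ y, -skew n (f j) q *
      (((if Function.update f j r i = r then skew n q y else 0) +
        (if Function.update f j r i = q then skew n r y else 0)) *
      v (Function.update (Function.update f j r) i y)) = 0 := by
    rw [Finset.sum_comm]
    refine Finset.sum_eq_zero fun r _ => ?_
    rw [Finset.sum_comm]
    refine Finset.sum_eq_zero fun q _ => ?_
    simp only [← Finset.mul_sum]
    rw [hv.sum_update_skew r q (Function.update f j r), mul_zero]
  have hinv : ∀ (w : Fin n ⊕ Fin n → ℂ) (x : Fin n ⊕ Fin n),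
      ∑ q, ∑ y, -skew n x q * (skew n q y * w y) = w x := by
    intro w x
    rw [Finset.sum_comm]
    have : ∀ y, ∑ q, -skew n x q * (skew n q y * w y) = if x = y then w y else 0 := by
      intro y
      have h := sum_skew_mul_skew x y
      calc _ = -(∑ q, skew n x q * skew n q y) * w y := by
            rw [← Finset.sum_neg_distrib, Finset.sum_mul]
            exact Finset.sum_congr rfl fun q _ => by ring
        _ = _ := by rw [h]; split_ifs <;> simp
    rw [Finset.sum_congr rfl fun y _ => this y, Finset.sum_ite_eq, if_pos (Finset.mem_univ _)]
  rw [← Finset.add_sum_erase _ _ (Finset.mem_univ j)] at hrel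
  refine Eq.trans ?_ hrel
  congr 1
  · simp only [Function.update_self, Function.update_idem, if_true, add_mul, mul_add,
      Finset.sum_add_distrib]
    -- The Kronecker delta r = r leaves r free and yields 2n copies of v f; the delta r = q yields
    -- one more.
    congr 1
    · rw [Finset.sum_congr rfl fun r _ => hinv (fun y => v (Function.update f j y)) (f j)]
      simp
    · rw [one_mul]
      simp only [ite_mul, zero_mul, mul_ite, mul_zero, Finset.sum_ite_irrel, Finset.sum_const_zero,
        Finset.sum_ite_eq, Finset.mem_univ, if_true]
      rw [hinv (fun y => v (Function.update f j y)) (f j), Function.update_eq_self]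
  · refine Finset.sum_congr rfl fun i hi => ?_
    have hij := (Finset.mem_erase.1 hi).1
    simp only [Function.update_of_ne hij, add_mul, mul_add, Finset.sum_add_distrib]
    have h2 : ∑ r, ∑ q, ∑ y, -skew n (f j) q * ((if f i = q then skew n r y else 0) *
        v (Function.update (Function.update f j r) i y)) = 0 := by
      calc _ = -skew n (f j) (f i) * ∑ r, ∑ y, skew n r y *
            v (Function.update (Function.update f j r) i y) := by
            rw [Finset.mul_sum]
            refine Finset.sum_congr rfl fun r _ => ?_
            rw [Finset.sum_comm, Finset.mul_sum]
            refine Finset.sum_congr rfl fun y _ => ?_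
            simp [ite_mul, mul_ite]
        _ = 0 := by rw [ht j i f hij.symm, mul_zero]
    rw [h2, add_zero]
    simp only [ite_mul, zero_mul, mul_ite, mul_zero, Finset.sum_ite_irrel, Finset.sum_const_zero,
        Finset.sum_ite_eq, Finset.mem_univ, if_true]
    rw [hinv (fun y => v (Function.update (Function.update f j (f i)) i y)) (f j)]
    congr 1
    funext l
    simp only [Function.comp_apply, Equiv.swap_apply_def, Function.update_apply]
    split_ifs <;> simp_all

theorem IsInvariant.eq_zero_of_isTraceless [Nonempty ι] {v : (ι → Fin n ⊕ Fin n) → ℂ}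
    (hv : IsInvariant v) (ht : IsTraceless v) : v = 0 :=
  (hv.isTranspositionEigenvector ht).eq_zero

end Invariant

/-! ### Perfect matchings and their tensors -/

section Matching

variable {ι : Type*} [LinearOrder ι] {n : ℕ}

/-- Perfect matchings of a linearly ordered set, as sets of increasing pairs. -/
def IsMatching (m : Finset (ι × ι)) : Prop :=
  (∀ p ∈ m, p.1 < p.2) ∧ ∀ j : ι, ∃! p : ι × ι, p ∈ m ∧ (j = p.1 ∨ j = p.2)

theorem IsMatching.eq_of_mem {m : Finset (ι × ι)} (hm : IsMatching m) {j : ι} {p q : ι × ι}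
    (hp : p ∈ m) (hjp : j = p.1 ∨ j = p.2) (hq : q ∈ m) (hjq : j = q.1 ∨ j = q.2) : p = q :=
  (hm.2 j).unique ⟨hp, hjp⟩ ⟨hq, hjq⟩

/-- A perfect matching splits the index set into first and second elements of its pairs. -/
noncomputable def IsMatching.equiv {m : Finset (ι × ι)} (hm : IsMatching m) : m ⊕ m ≃ ι :=
  Equiv.ofBijective (Sum.elim (fun p => p.1.1) fun p => p.1.2) (by
    constructor
    · rintro (p | p) (q | q) h
      · exact congrArg _ (Subtype.ext (hm.eq_of_mem p.2 (Or.inl rfl) q.2 (Or.inl h)))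
      · have hpq := Subtype.ext (hm.eq_of_mem p.2 (Or.inl rfl) q.2 (Or.inr h))
        subst hpq
        exact absurd h (hm.1 _ p.2).ne
      · have hpq := Subtype.ext (hm.eq_of_mem p.2 (Or.inr rfl) q.2 (Or.inl h))
        subst hpq
        exact absurd h (hm.1 _ p.2).ne'
      · exact congrArg _ (Subtype.ext (hm.eq_of_mem p.2 (Or.inr rfl) q.2 (Or.inr h)))
    · intro j
      obtain ⟨p, ⟨hp, hj | hj⟩, -⟩ := hm.2 j
      · exact ⟨Sum.inl ⟨p, hp⟩, hj.symm⟩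
      · exact ⟨Sum.inr ⟨p, hp⟩, hj.symm⟩)

/-- The tensor with coordinates `∏ a(e_{f(p.1)}, e_{f(p.2)})` over the pairs `p`. -/
def pairingTensor (n : ℕ) (m : Finset (ι × ι)) : (ι → Fin n ⊕ Fin n) → ℂ :=
  fun f => ∏ p ∈ m, skew n (f p.1) (f p.2)

variable [Fintype ι]

theorem IsMatching.prod_eq {m : Finset (ι × ι)} (hm : IsMatching m) (c : ι → ℂ) :
    ∏ i, c i = ∏ p ∈ m, c p.1 * c p.2 := by
  rw [← hm.equiv.prod_comp, Fintype.prod_sum_type, ← Finset.prod_mul_distrib]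
  exact Finset.prod_coe_sort m fun p => c p.1 * c p.2

theorem IsMatching.two_mul_card {m : Finset (ι × ι)} (hm : IsMatching m) :
    2 * m.card = Fintype.card ι := by
  rw [← Fintype.card_congr hm.equiv, Fintype.card_sum, Fintype.card_coe]
  ring

/-- A sum over all functions of a product over the pairs of a matching factorises. -/
theorem IsMatching.sum_prod {X : Type*} [Fintype X] {m : Finset (ι × ι)} (hm : IsMatching m)
    (A : ι × ι → X → X → ℂ) :
    ∑ f : ι → X, ∏ p ∈ m, A p (f p.1) (f p.2) = ∏ p ∈ m, ∑ x, ∑ y, A p x y := by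
  -- Through the matching, a function on the slots is an independent choice of two values for each
  -- pair.
  let E : (ι → X) ≃ (m → X × X) :=
    ((Equiv.arrowCongr hm.equiv.symm (Equiv.refl X)).trans
      (Equiv.sumArrowEquivProdArrow m m X)).trans
      (Equiv.arrowProdEquivProdArrow m (fun _ => X) (fun _ => X)).symm
  have hE : ∀ f p, E f p = (f p.1.1, f p.1.2) := fun f p => rfl
  calc _ = ∑ f : ι → X, ∏ p : m, A p.1 (E f p).1 (E f p).2 := by
        refine Finset.sum_congr rfl fun f _ => ?_
        rw [← Finset.prod_coe_sort m fun p => A p (f p.1) (f p.2)]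
        exact Finset.prod_congr rfl fun p _ => by rw [hE]
    _ = ∑ F : m → X × X, ∏ p : m, A p.1 (F p).1 (F p).2 :=
        E.sum_comp fun F => ∏ p : m, A p.1 (F p).1 (F p).2
    _ = ∏ p : m, ∑ z : X × X, A p.1 z.1 z.2 :=
        (Fintype.prod_sum fun (p : m) (z : X × X) => A p.1 z.1 z.2).symm
    _ = _ := by
        rw [← Finset.prod_coe_sort m fun p => ∑ x, ∑ y, A p x y]
        exact Finset.prod_congr rfl fun p _ =>
          Fintype.sum_prod_type fun z : X × X => A p.1 z.1 z.2

theorem IsMatching.sum_prod_mul_pairingTensor {m : Finset (ι × ι)} (hm : IsMatching m)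
    {A : Matrix (Fin n ⊕ Fin n) (Fin n ⊕ Fin n) ℂ} (hA : A * skew n * A.transpose = skew n)
    (f : ι → Fin n ⊕ Fin n) :
    ∑ h, (∏ i, A (f i) (h i)) * pairingTensor n m h = pairingTensor n m f := by
  have hxy : ∀ a b, ∑ x, ∑ y, A a x * A b y * skew n x y = skew n a b := by
    intro a b
    conv_rhs => rw [← hA]
    rw [Matrix.mul_apply, Finset.sum_comm]
    refine Finset.sum_congr rfl fun y _ => ?_
    rw [Matrix.mul_apply, Finset.sum_mul]
    exact Finset.sum_congr rfl fun x _ => by rw [Matrix.transpose_apply]; ring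
  calc _ = ∑ h : ι → Fin n ⊕ Fin n, ∏ p ∈ m,
        A (f p.1) (h p.1) * A (f p.2) (h p.2) * skew n (h p.1) (h p.2) := by
        refine Finset.sum_congr rfl fun h _ => ?_
        rw [hm.prod_eq, pairingTensor, ← Finset.prod_mul_distrib]
    _ = ∏ p ∈ m, ∑ x, ∑ y, A (f p.1) x * A (f p.2) y * skew n x y :=
        hm.sum_prod fun p x y => A (f p.1) x * A (f p.2) y * skew n x y
    _ = _ := Finset.prod_congr rfl fun p _ => hxy _ _

theorem IsMatching.isInvariant {m : Finset (ι × ι)} (hm : IsMatching m) :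
    IsInvariant (pairingTensor n m) :=
  fun g f => hm.sum_prod_mul_pairingTensor (Sp.mul_skew_mul_transpose g) f

end Matching

/-! ### Contraction of two slots -/

section Contraction

variable {ι : Type*} [DecidableEq ι] {X : Type*}

/-- Extend a function by prescribed values at `i` and `j`. -/
def extendPair (i j : ι) (f : {l : ι // l ≠ i ∧ l ≠ j} → X) (x y : X) : ι → X :=
  fun l => if h : l ≠ i ∧ l ≠ j then f ⟨l, h⟩ else if l = i then x else y

theorem extendPair_left (i j : ι) (f : {l : ι // l ≠ i ∧ l ≠ j} → X) (x y : X) :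
    extendPair i j f x y i = x := by
  simp [extendPair]

theorem extendPair_right {i j : ι} (hij : i ≠ j) (f : {l : ι // l ≠ i ∧ l ≠ j} → X) (x y : X) :
    extendPair i j f x y j = y := by
  simp [extendPair, hij.symm]

theorem extendPair_coe (i j : ι) (f : {l : ι // l ≠ i ∧ l ≠ j} → X) (x y : X)
    (l : {l : ι // l ≠ i ∧ l ≠ j}) : extendPair i j f x y l = f l := by
  simp [extendPair, l.2]

theorem extendPair_restrict (i j : ι) (f : ι → X) (x y : X) :
    extendPair i j (fun l => f l) x y = Function.update (Function.update f j y) i x := by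
  funext l
  simp only [extendPair, Function.update_apply]
  split_ifs <;> simp_all

variable [Fintype ι]

theorem sum_extendPair [Fintype X] {i j : ι} (hij : i ≠ j) (F : (ι → X) → ℂ) :
    ∑ f, F f = ∑ f : {l : ι // l ≠ i ∧ l ≠ j} → X, ∑ x, ∑ y, F (extendPair i j f x y) := by
  let E : ({l : ι // l ≠ i ∧ l ≠ j} → X) × X × X ≃ (ι → X) :=
    { toFun := fun z => extendPair i j z.1 z.2.1 z.2.2
      invFun := fun f => (fun l => f l, f i, f j)
      left_inv := fun z => by
        simp only [extendPair_coe, extendPair_left, extendPair_right hij]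
      right_inv := fun f => by
        simp [extendPair_restrict] }
  rw [← E.sum_comp, Fintype.sum_prod_type]
  exact Finset.sum_congr rfl fun f _ => Fintype.sum_prod_type _

theorem prod_eq_mul_mul_prod {i j : ι} (hij : i ≠ j) (c : ι → ℂ) :
    ∏ l, c l = c i * c j * ∏ l : {l : ι // l ≠ i ∧ l ≠ j}, c l := by
  rw [← Finset.mul_prod_erase _ _ (Finset.mem_univ i),
    ← Finset.mul_prod_erase _ _ (Finset.mem_erase.2 ⟨hij.symm, Finset.mem_univ j⟩), ← mul_assoc]
  congr 1
  refine Finset.prod_subtype _ (fun l => ?_) c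
  simp [and_comm]

variable {n : ℕ}

/-- Contraction of the slots `i` and `j` with the symplectic form. -/
def contract (i j : ι) (v : (ι → Fin n ⊕ Fin n) → ℂ) :
    ({l : ι // l ≠ i ∧ l ≠ j} → Fin n ⊕ Fin n) → ℂ :=
  fun f => ∑ x, ∑ y, skew n x y * v (extendPair i j f x y)

/-- Replacing J by gᵀ J g in the contraction supplies the two missing factors of g; invariance of v
on all slots then applies. -/
theorem isInvariant_contract {i j : ι} (hij : i ≠ j) {v : (ι → Fin n ⊕ Fin n) → ℂ}
    (hv : IsInvariant v) : IsInvariant (contract i j v) := by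
  intro g f
  have hg : ∀ x y, ∑ a, ∑ b, skew n a b * (g.1.1 a x * g.1.1 b y) = skew n x y := by
    intro x y
    conv_rhs => rw [← Sp.transpose_mul_skew_mul g]
    rw [Matrix.mul_apply, Finset.sum_comm]
    refine Finset.sum_congr rfl fun b _ => ?_
    rw [Matrix.mul_apply, Finset.sum_mul]
    exact Finset.sum_congr rfl fun x _ => by rw [Matrix.transpose_apply]; ring
  calc ∑ h, (∏ l, g.1.1 (f l) (h l)) * contract i j v h
      = ∑ h : {l : ι // l ≠ i ∧ l ≠ j} → Fin n ⊕ Fin n, ∑ x, ∑ y, ∑ a, ∑ b, skew n a b *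
          ((∏ l, g.1.1 (extendPair i j f a b l) (extendPair i j h x y l)) *
            v (extendPair i j h x y)) := by
        refine Finset.sum_congr rfl fun h _ => ?_
        rw [contract, Finset.mul_sum]
        refine Finset.sum_congr rfl fun x _ => ?_
        rw [Finset.mul_sum]
        refine Finset.sum_congr rfl fun y _ => ?_
        rw [← hg x y, Finset.sum_mul, Finset.mul_sum]
        refine Finset.sum_congr rfl fun a _ => ?_
        rw [Finset.sum_mul, Finset.mul_sum]
        refine Finset.sum_congr rfl fun b _ => ?_
        rw [prod_eq_mul_mul_prod hij]
        simp only [extendPair_left, extendPair_right hij, extendPair_coe]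
        ring
    _ = ∑ h : ι → Fin n ⊕ Fin n, ∑ a, ∑ b, skew n a b *
          ((∏ l, g.1.1 (extendPair i j f a b l) (h l)) * v h) :=
        (sum_extendPair hij fun h => ∑ a, ∑ b, skew n a b *
          ((∏ l, g.1.1 (extendPair i j f a b l) (h l)) * v h)).symm
    _ = ∑ a, ∑ b, skew n a b * ∑ h : ι → Fin n ⊕ Fin n,
          ((∏ l, g.1.1 (extendPair i j f a b l) (h l)) * v h) := by
        rw [Finset.sum_comm]
        refine Finset.sum_congr rfl fun a _ => ?_
        rw [Finset.sum_comm]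
        refine Finset.sum_congr rfl fun b _ => ?_
        rw [Finset.mul_sum]
    _ = _ := by
        simp only [hv g]
        rfl

end Contraction

/-! ### The first fundamental theorem -/

section FirstFundamentalTheorem

variable {n : ℕ}

/-- Add the pair `(i, j)` to a set of pairs of the remaining indices. -/
def insertPair {ι : Type*} [DecidableEq ι] (i j : ι)
    (m : Finset ({l : ι // l ≠ i ∧ l ≠ j} × {l : ι // l ≠ i ∧ l ≠ j})) : Finset (ι × ι) :=
  insert (i, j) (m.map ((Function.Embedding.subtype _).prodMap (Function.Embedding.subtype _)))

theorem mem_insertPair {ι : Type*} [DecidableEq ι] {i j : ι}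
    {m : Finset ({l : ι // l ≠ i ∧ l ≠ j} × {l : ι // l ≠ i ∧ l ≠ j})} {p : ι × ι} :
    p ∈ insertPair i j m ↔ p = (i, j) ∨ ∃ q ∈ m, ((q.1 : ι), (q.2 : ι)) = p := by
  rw [insertPair, Finset.mem_insert, Finset.mem_map]
  rfl

theorem IsMatching.insertPair {ι : Type*} [LinearOrder ι] {i j : ι} (hij : i < j)
    {m : Finset ({l : ι // l ≠ i ∧ l ≠ j} × {l : ι // l ≠ i ∧ l ≠ j})} (hm : IsMatching m) :
    IsMatching (insertPair i j m) := by
  refine ⟨?_, fun l => ?_⟩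
  · intro p hp
    rcases mem_insertPair.1 hp with rfl | ⟨q, hq, rfl⟩
    · exact hij
    · exact hm.1 q hq
  · by_cases hl : l ≠ i ∧ l ≠ j
    · obtain ⟨q, ⟨hq, hlq⟩, huniq⟩ := hm.2 ⟨l, hl⟩
      refine ⟨(q.1, q.2), ⟨mem_insertPair.2 (Or.inr ⟨q, hq, rfl⟩), ?_⟩, ?_⟩
      · exact hlq.imp (congrArg Subtype.val) (congrArg Subtype.val)
      · rintro p ⟨hp, hlp⟩
        rcases mem_insertPair.1 hp with rfl | ⟨q', hq', rfl⟩
        · exact (hlp.elim hl.1 hl.2).elim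
        · rw [huniq q' ⟨hq', hlp.imp Subtype.ext Subtype.ext⟩]
    · have hl' : l = i ∨ l = j := by
        by_contra hcon
        exact hl (not_or.1 hcon)
      refine ⟨(i, j), ⟨mem_insertPair.2 (Or.inl rfl), hl'⟩, ?_⟩
      rintro p ⟨hp, hlp⟩
      rcases mem_insertPair.1 hp with rfl | ⟨q, hq, rfl⟩
      · rfl
      · rcases hlp with rfl | rfl
        · exact absurd q.1.2 hl
        · exact absurd q.2.2 hl

theorem pairingTensor_insertPair {ι : Type*} [LinearOrder ι] {i j : ι} (hij : i ≠ j)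
    (m : Finset ({l : ι // l ≠ i ∧ l ≠ j} × {l : ι // l ≠ i ∧ l ≠ j}))
    (f : {l : ι // l ≠ i ∧ l ≠ j} → Fin n ⊕ Fin n) (x y : Fin n ⊕ Fin n) :
    pairingTensor n (insertPair i j m) (extendPair i j f x y) =
      skew n x y * pairingTensor n m f := by
  rw [pairingTensor, insertPair, Finset.prod_insert, Finset.prod_map, extendPair_left,
    extendPair_right hij]
  · congr 1
    exact Finset.prod_congr rfl fun p _ =>
      congrArg₂ (skew n) (extendPair_coe i j f x y p.1) (extendPair_coe i j f x y p.2)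
  · intro h
    obtain ⟨q, -, hq⟩ := Finset.mem_map.1 h
    exact q.1.2.1 (congrArg Prod.fst hq)

/-- Contraction is adjoint to adjoining a pair; this carries the orthogonality hypothesis down the
induction. -/
theorem sum_pairingTensor_mul_contract {ι : Type*} [LinearOrder ι] [Fintype ι] {i j : ι}
    (hij : i ≠ j) (m : Finset ({l : ι // l ≠ i ∧ l ≠ j} × {l : ι // l ≠ i ∧ l ≠ j}))
    (v : (ι → Fin n ⊕ Fin n) → ℂ) :
    ∑ f, pairingTensor n m f * contract i j v f =
      ∑ f, pairingTensor n (insertPair i j m) f * v f := by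
  rw [sum_extendPair hij]
  refine Finset.sum_congr rfl fun f _ => ?_
  rw [contract, Finset.mul_sum]
  refine Finset.sum_congr rfl fun x _ => ?_
  rw [Finset.mul_sum]
  refine Finset.sum_congr rfl fun y _ => ?_
  rw [pairingTensor_insertPair hij]
  ring

/-- An invariant tensor orthogonal to all pairing tensors vanishes. -/
theorem IsInvariant.eq_zero_of_orthogonal {ι : Type*} [LinearOrder ι] [Fintype ι]
    {v : (ι → Fin n ⊕ Fin n) → ℂ} (hv : IsInvariant v)
    (horth : ∀ m : Finset (ι × ι), IsMatching m → ∑ f, pairingTensor n m f * v f = 0) : v = 0 := by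
  induction hN : Fintype.card ι using Nat.strong_induction_on generalizing ι with
  | _ N ih =>
  rcases isEmpty_or_nonempty ι with hι | hι
  -- With no slots the empty matching has tensor 1, so orthogonality to it is already v = 0.
  · have h := horth ∅ ⟨by simp, fun j => isEmptyElim j⟩
    funext f
    rw [Fintype.sum_unique] at h
    simp only [pairingTensor, Finset.prod_empty, one_mul] at h
    rw [Subsingleton.elim f default, h]
    rfl
  · have hlt : ∀ (i j : ι), i < j → ∀ f : ι → Fin n ⊕ Fin n,
        ∑ x, ∑ y, skew n x y * v (Function.update (Function.update f i x) j y) = 0 := by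
      intro i j hij f
      have hcard : Fintype.card {l : ι // l ≠ i ∧ l ≠ j} < N := by
        rw [← hN]
        exact Fintype.card_subtype_lt (x := i) (by simp)
      have h0 := ih _ hcard (v := contract i j v) (by convert isInvariant_contract hij.ne hv)
        (fun m hm => by
          have := horth _ (hm.insertPair hij)
          rw [← sum_pairingTensor_mul_contract hij.ne] at this
          convert this) (by congr)
      have h1 := congrFun h0 fun l => f l
      simp only [contract, extendPair_restrict] at h1
      rw [Pi.zero_apply] at h1
      rw [← h1]
      refine Finset.sum_congr rfl fun x _ => Finset.sum_congr rfl fun y _ => ?_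
      rw [Function.update_comm hij.ne]
    refine hv.eq_zero_of_isTraceless fun i j f hij => ?_
    rcases lt_or_gt_of_ne hij with h | h
    · exact hlt i j h f
    · have h1 := hlt j i h f
      calc _ = -∑ y, ∑ x, skew n y x * v (Function.update (Function.update f j y) i x) := by
            rw [Finset.sum_comm, ← Finset.sum_neg_distrib]
            refine Finset.sum_congr rfl fun y _ => ?_
            rw [← Finset.sum_neg_distrib]
            refine Finset.sum_congr rfl fun x _ => ?_
            rw [Function.update_comm hij, skew_apply_swap x y, neg_mul]
        _ = 0 := by rw [h1, neg_zero]

end FirstFundamentalTheorem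

/-! ### Coordinates of the tensors `theta` -/

section Theta

variable {n k : ℕ}

theorem PairPartition.isMatching (m : PairPartition k) : IsMatching m.pairs := m.2

theorem PairPartition.pairOf_eq (m : PairPartition k) {j : Fin k} (p : m.pairs)
    (h : j = p.1.1 ∨ j = p.1.2) : m.pairOf j = p :=
  Subtype.ext (m.isMatching.eq_of_mem (m.pairOf j).2 (m.2.2 j).choose_spec.1.2 p.2 h)

/-- This is the case of a single pair: ∑ (e_i ⊗ e_{n+i} - e_{n+i} ⊗ e_i) has coordinate matrix J. -/
theorem sum_sum_e_idx (x y : Fin n ⊕ Fin n) :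
    ∑ i : Fin n, ∑ s : Fin 2, e (idx i s) x * ((-1 : ℂ) ^ (s : ℕ) • e (idx i (1 - s))) y =
      skew n x y := by
  rcases x with x | x <;> rcases y with y | y <;>
    simp [Fin.sum_univ_two, idx, e, skew, Pi.single_apply, Matrix.one_apply, eq_comm, neg_ite]

theorem theta_apply (m : PairPartition k) (f : Fin k → Fin n ⊕ Fin n) :
    theta n m f = pairingTensor n m.pairs f := by
  have hvec : ∀ (η : m.pairs → Fin n) (ε : m.pairs → Fin 2), pureTensor (thetaVec m η ε) f =
      ∏ p : m.pairs, e (idx (η p) (ε p)) (f p.1.1) *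
        ((-1 : ℂ) ^ (ε p : ℕ) • e (idx (η p) (1 - ε p))) (f p.1.2) := by
    intro η ε
    rw [pureTensor, m.isMatching.prod_eq, ← Finset.prod_coe_sort]
    refine Finset.prod_congr rfl fun p _ => ?_
    have h1 := m.pairOf_eq p (Or.inl rfl)
    have h2 := m.pairOf_eq p (Or.inr rfl)
    have h3 : p.1.2 ≠ p.1.1 := (m.isMatching.1 _ p.2).ne'
    simp only [thetaVec, h1, h2, if_true, if_neg h3]
  rw [theta, pairingTensor, ← Finset.prod_coe_sort m.pairs fun p => skew n (f p.1) (f p.2)]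
  simp only [Finset.sum_apply, hvec, ← sum_sum_e_idx]
  rw [Fintype.prod_sum]
  refine Finset.sum_congr rfl fun η _ => ?_
  rw [Fintype.prod_sum]

theorem symplForm_e_e (x y : Fin n ⊕ Fin n) : symplForm (e x) (e y) = skew n x y := by
  rcases x with x | x <;> rcases y with y | y <;>
    simp [symplForm, e, skew, Pi.single_apply, Matrix.one_apply, eq_comm]

/-- J itself lies in Sp, so applying it to every slot fixes θ_{m'}; the form a therefore agrees with
the plain coordinate pairing on these tensors. -/
theorem gram_apply (m m' : PairPartition k) :
    gram n k m m' = ∑ f, pairingTensor n m.pairs f * pairingTensor n m'.pairs f := by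
  obtain ⟨g, hg⟩ := skew_mem_Sp n
  have hinv := m'.isMatching.isInvariant (n := n) g
  rw [hg] at hinv
  simp only [gram, Matrix.of_apply, tensorForm, theta_apply, symplForm_e_e]
  refine Finset.sum_congr rfl fun f _ => ?_
  rw [← hinv f, Finset.mul_sum]
  exact Finset.sum_congr rfl fun h _ => by ring

theorem star_pairingTensor (m : PairPartition k) (f : Fin k → Fin n ⊕ Fin n) :
    star (pairingTensor n m.pairs f) = pairingTensor n m.pairs f := by
  rw [pairingTensor, star_prod]
  exact Finset.prod_congr rfl fun p _ =>
    congrFun (congrFun (skew_map_conj n) (f p.1)) (f p.2)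

/-- The product `gram * Wg` acts as the identity on the coordinates of the tensors `theta`. -/
theorem sum_gram_mul_Wg_mul (m : PairPartition k) (h : Fin k → Fin n ⊕ Fin n) :
    ∑ m' : PairPartition k, (gram n k * Wg n k) m m' * pairingTensor n m'.pairs h =
      pairingTensor n m.pairs h := by
  classical
  let T : Matrix (PairPartition k) (Fin k → Fin n ⊕ Fin n) ℂ :=
    Matrix.of fun m f => pairingTensor n m.pairs f
  have hT : gram n k = T * T.conjTranspose := by
    ext m m'
    rw [gram_apply, Matrix.mul_apply]
    refine Finset.sum_congr rfl fun f _ => ?_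
    rw [Matrix.conjTranspose_apply]
    exact congrArg _ (star_pairingTensor m' f).symm
  have hG : gram n k * Wg n k * gram n k = gram n k :=
    (exists_isMoorePenrose (gram n k)).choose_spec.1
  have hD : gram n k * Wg n k * T - T = 0 := by
    -- For D = (GW - 1)T, the identity GWG = G gives D Tᴴ = 0, hence D Dᴴ = 0 and D = 0.
    -- Invertibility of G is not needed.
    have h0 : (gram n k * Wg n k * T - T) * (gram n k * Wg n k * T - T).conjTranspose = 0 := by
      have e1 : (gram n k * Wg n k * T - T) * T.conjTranspose = 0 := by
        rw [Matrix.sub_mul, Matrix.mul_assoc, ← hT, hG, sub_self]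
      have e2 : (gram n k * Wg n k * T - T).conjTranspose =
          T.conjTranspose * (gram n k * Wg n k - 1).conjTranspose := by
        rw [← Matrix.conjTranspose_mul, Matrix.sub_mul, Matrix.one_mul]
      rw [e2, ← Matrix.mul_assoc, e1, Matrix.zero_mul]
    open scoped ComplexOrder in
    exact Matrix.self_mul_conjTranspose_eq_zero.1 h0
  have := congrFun (congrFun (sub_eq_zero.1 hD) m) h
  rwa [Matrix.mul_apply] at this

end Theta

/-! ### Moments of the Haar measure -/

section Haar

variable {n k : ℕ}

instance (n : ℕ) : (haarSp n).IsHaarMeasure := by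
  unfold haarSp
  infer_instance

theorem haarSp_univ (n : ℕ) : haarSp n Set.univ = 1 :=
  Measure.haarMeasure_self (K₀ := (⊤ : TopologicalSpace.PositiveCompacts (Sp n)))

theorem integrable_prod_entries (f h : Fin k → Fin n ⊕ Fin n) :
    Integrable (fun g : Sp n => ∏ j, g.1.1 (f j) (h j)) (haarSp n) := by
  refine Continuous.integrable_of_hasCompactSupport ?_ (HasCompactSupport.of_compactSpace _)
  refine continuous_finsetProd _ fun j _ => ?_
  exact (continuous_subtype_val.comp continuous_subtype_val).matrix_elem (f j) (h j)

theorem isInvariant_integral (h : Fin k → Fin n ⊕ Fin n) :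
    IsInvariant fun f : Fin k → Fin n ⊕ Fin n =>
      ∫ g : Sp n, ∏ j, g.1.1 (f j) (h j) ∂(haarSp n) := by
  intro x f
  beta_reduce
  -- Left translation by x replaces g by xg, and expanding the entries of xg gives the action of x
  -- on the row indices.
  rw [← integral_mul_left_eq_self (fun g : Sp n => ∏ j, g.1.1 (f j) (h j)) x]
  simp only [← integral_const_mul]
  rw [← integral_finsetSum _ fun f' _ => (integrable_prod_entries f' h).const_mul _]
  refine integral_congr_ae (Filter.Eventually.of_forall fun g => ?_)
  change _ = ∏ j, (x.1.1 * g.1.1) (f j) (h j)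
  simp only [Matrix.mul_apply]
  rw [Fintype.prod_sum]
  simp only [Finset.prod_mul_distrib]

/-- The integrand summed over f is constant in g: the columns of g enter through gᵀ, which fixes
θ_m, and the total mass is one. -/
theorem sum_pairingTensor_mul_integral (m : PairPartition k) (h : Fin k → Fin n ⊕ Fin n) :
    ∑ f, pairingTensor n m.pairs f * ∫ g : Sp n, ∏ j, g.1.1 (f j) (h j) ∂(haarSp n) =
      pairingTensor n m.pairs h := by
  simp only [← integral_const_mul]
  rw [← integral_finsetSum _ fun f' _ => (integrable_prod_entries f' h).const_mul _]
  have hconst : ∀ g : Sp n, ∑ f, pairingTensor n m.pairs f * ∏ j, g.1.1 (f j) (h j) =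
      pairingTensor n m.pairs h := by
    intro g
    rw [← m.isMatching.sum_prod_mul_pairingTensor (A := g.1.1.transpose)
      (by rw [Matrix.transpose_transpose]; exact Sp.transpose_mul_skew_mul g) h]
    exact Finset.sum_congr rfl fun f _ => mul_comm _ _
  simp only [hconst]
  simp [Measure.real, haarSp_univ]

/-- The Weingarten formula in terms of the coordinates of the tensors `theta`. -/
theorem integral_prod_entries (f h : Fin k → Fin n ⊕ Fin n) :
    ∫ g : Sp n, ∏ j, g.1.1 (f j) (h j) ∂(haarSp n) =
      ∑ m : PairPartition k, ∑ m' : PairPartition k,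
        Wg n k m m' * pairingTensor n m.pairs f * pairingTensor n m'.pairs h := by
  let v : (Fin k → Fin n ⊕ Fin n) → ℂ := fun f =>
    ∫ g : Sp n, ∏ j, g.1.1 (f j) (h j) ∂(haarSp n)
  let c : PairPartition k → ℂ := fun m =>
    ∑ m' : PairPartition k, Wg n k m m' * pairingTensor n m'.pairs h
  let w : (Fin k → Fin n ⊕ Fin n) → ℂ := fun f =>
    v f - ∑ m : PairPartition k, c m * pairingTensor n m.pairs f
  have hw : IsInvariant w := by
    intro g f
    simp only [w, mul_sub, Finset.sum_sub_distrib, Finset.mul_sum]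
    congr 1
    · exact isInvariant_integral h g f
    · rw [Finset.sum_comm]
      refine Finset.sum_congr rfl fun m _ => ?_
      rw [← m.isMatching.isInvariant g f, Finset.mul_sum]
      exact Finset.sum_congr rfl fun f' _ => by ring
  -- Pairing w with θ_m gives θ_m(h) minus the m-th entry of G W applied to the vector of all
  -- θ_{m'}(h), which is zero.
  have hw0 : w = 0 := by
    refine hw.eq_zero_of_orthogonal fun m₀ hm₀ => ?_
    let m : PairPartition k := ⟨m₀, hm₀⟩
    change ∑ f, pairingTensor n m.pairs f * w f = 0
    simp only [w, mul_sub, Finset.sum_sub_distrib]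
    rw [sub_eq_zero]
    refine (sum_pairingTensor_mul_integral m h).trans ?_
    rw [← sum_gram_mul_Wg_mul m h]
    calc _ = ∑ m' : PairPartition k, ∑ m'' : PairPartition k,
          gram n k m m'' * (Wg n k m'' m' * pairingTensor n m'.pairs h) := by
          refine Finset.sum_congr rfl fun m' _ => ?_
          rw [Matrix.mul_apply, Finset.sum_mul]
          exact Finset.sum_congr rfl fun m'' _ => mul_assoc _ _ _
      _ = ∑ m'' : PairPartition k, gram n k m m'' * c m'' := by
          rw [Finset.sum_comm]
          simp only [c, Finset.mul_sum]
      _ = ∑ m'' : PairPartition k, ∑ f, pairingTensor n m.pairs f *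
            (c m'' * pairingTensor n m''.pairs f) := by
          refine Finset.sum_congr rfl fun m'' _ => ?_
          rw [gram_apply, Finset.sum_mul]
          exact Finset.sum_congr rfl fun f _ => by ring
      _ = _ := by
          rw [Finset.sum_comm]
          simp only [Finset.mul_sum]
  have h1 := sub_eq_zero.1 (congrFun hw0 f)
  refine h1.trans (Finset.sum_congr rfl fun m _ => ?_)
  simp only [c, Finset.sum_mul]
  exact Finset.sum_congr rfl fun m' _ => by ring

end Haar

/-! ### Signs -/

section Sign

variable {n k : ℕ}

theorem idx_inj {i j : Fin n} {s t : Fin 2} : idx i s = idx j t ↔ i = j ∧ s = t := by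
  fin_cases s <;> fin_cases t <;> simp [idx]

/-- The value is +1 for s = 0; the outer minus sign is split off so that the product counts the
pairs with s = 0, at the cost of one global sign per pair. -/
theorem skew_idx_idx (i j : Fin n) (s t : Fin 2) :
    skew n (idx i s) (idx j t) =
      if i = j ∧ s ≠ t then -(if s = 0 then -1 else 1 : ℂ) else 0 := by
  fin_cases s <;> fin_cases t <;> simp [idx, skew, Matrix.one_apply, neg_ite]

theorem pair_eq_zero_one_iff (s t : Fin 2) : ({s, t} : Set (Fin 2)) = {0, 1} ↔ s ≠ t := by
  constructor
  · rintro h rfl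
    have h0 : (0 : Fin 2) ∈ ({s, s} : Set (Fin 2)) := h ▸ by simp
    have h1 : (1 : Fin 2) ∈ ({s, s} : Set (Fin 2)) := h ▸ by simp
    simp only [Set.mem_insert_iff, Set.mem_singleton_iff, or_self] at h0 h1
    exact absurd (h0.trans h1.symm) (by decide)
  · intro h
    fin_cases s <;> fin_cases t
    · exact absurd rfl h
    · rfl
    · exact Set.pair_comm _ _
    · exact absurd rfl h

theorem mem_F_idx_iff (m : PairPartition k) (φ : Fin k → Fin n) (α : Fin k → Fin 2) :
    (fun j => idx (φ j) (α j)) ∈ F n m ↔ ∀ p ∈ m.pairs, φ p.1 = φ p.2 ∧ α p.1 ≠ α p.2 := by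
  simp only [F, Set.mem_ofPred_eq, pair_eq_zero_one_iff]
  constructor
  · rintro ⟨φ', α', h, h1, h2⟩ p hp
    have hφ := fun j => (idx_inj.1 (congrFun h j)).1
    have hα := fun j => (idx_inj.1 (congrFun h j)).2
    simp only [hφ, hα]
    exact ⟨h1 p hp, h2 p hp⟩
  · intro h
    exact ⟨φ, α, rfl, fun p hp => (h p hp).1, fun p hp => (h p hp).2⟩

theorem pairingTensor_idx (m : PairPartition k) (φ : Fin k → Fin n) (α : Fin k → Fin 2) :
    pairingTensor n m.pairs (fun j => idx (φ j) (α j)) = (-1) ^ m.pairs.card *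
      (-1) ^ (m.pairs.filter fun p => α p.1 = 0).card *
        (F n m).indicator 1 (fun j => idx (φ j) (α j)) := by
  simp only [pairingTensor, skew_idx_idx]
  by_cases h : (fun j => idx (φ j) (α j)) ∈ F n m
  · rw [Set.indicator_of_mem h, Pi.one_apply, mul_one]
    rw [mem_F_idx_iff] at h
    rw [Finset.prod_congr rfl fun p hp => if_pos (h p hp), Finset.prod_neg, Finset.prod_ite]
    simp
  · rw [Set.indicator_of_notMem h, mul_zero]
    rw [mem_F_idx_iff] at h
    push Not at h
    obtain ⟨p, hp, hne⟩ := h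
    exact Finset.prod_eq_zero hp (if_neg fun hcon => hcon.2 (hne hcon.1))

end Sign

end SymplecticWeingarten

open SymplecticWeingarten in
theorem proposition3p2 (n k : ℕ) (φ ψ : Fin k → Fin n) (α β : Fin k → Fin 2) :
    ∫ g : Sp n, ∏ j : Fin k,
        (g : Matrix (Fin n ⊕ Fin n) (Fin n ⊕ Fin n) ℂ) (idx (φ j) (α j)) (idx (ψ j) (β j))
        ∂(haarSp n) =
      ∑ m : PairPartition k, ∑ m' : PairPartition k,
        Wg n k m m' *
          (-1 : ℂ) ^ ((m.pairs.filter fun p => α p.1 = 0).card +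
            (m'.pairs.filter fun p => β p.1 = 0).card) *
          (F n m).indicator 1 (fun j => idx (φ j) (α j)) *
          (F n m').indicator 1 (fun j => idx (ψ j) (β j)) := by
  refine (integral_prod_entries (fun j => idx (φ j) (α j)) fun j => idx (ψ j) (β j)).trans ?_
  refine Finset.sum_congr rfl fun m _ => Finset.sum_congr rfl fun m' _ => ?_
  -- Both pair partitions have k/2 pairs, so the two global signs (-1)^(k/2) cancel.
  have hcard : m'.pairs.card = m.pairs.card := by
    have h1 := m.isMatching.two_mul_card
    have h2 := m'.isMatching.two_mul_card
    omega
  have hsign : (-1 : ℂ) ^ m.pairs.card * (-1) ^ m.pairs.card = 1 := by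
    rw [← mul_pow]
    simp
  rw [pairingTensor_idx, pairingTensor_idx, hcard, pow_add]
  linear_combination (Wg n k m m' * (-1 : ℂ) ^ (m.pairs.filter fun p => α p.1 = 0).card *
    (-1 : ℂ) ^ (m'.pairs.filter fun p => β p.1 = 0).card *
    (F n m).indicator 1 (fun j => idx (φ j) (α j)) *
    (F n m').indicator 1 (fun j => idx (ψ j) (β j))) * hsign
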